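/- **The model.** Let $\Phi$ be a homogeneous Poisson point process on $\mathbb{R}^d\times\mathbb{R}$ with intensity $\lambda$ (locations and arrival times). Its points $(x,t)$ carry i.i.d. marks $(C_{(x,t)},\sigma_{(x,t)})$, independent of $\Phi$, where $C_{(x,t)}$ is a random closed set of $\mathbb{R}^d$ and $\sigma_{(x,t)}\ge 0$ is a random height (the two may be dependent). Let $(C,\sigma)$ denote a typical mark and $\xi=\operatorname{diam}(C)$, and assume light tails: $\xi<\infty$ a.s. and, for some $c>0$, $\mathbb{E}\exp(c\,\xi^d)<\infty$ and $\mathbb{E}\exp(c\,\sigma)<\infty$. The *stick heap* has heights $H_{(x,t)}\in[-\infty,\infty]$, $x\in\mathbb{R}^d$, $t\ge 0$, with $H_{(0,0)}=0$ and $H_{(x,0)}=-\infty$ for $x\neq 0$. At the arrival of a hailstone $(z,s)\in\Phi$, $s\ge 0$, the height over every $x\in C_{(z,s)}+z$ becomes $\sigma_{(z,s)}+\sup_{y\in C_{(z,s)}+z}H_{(y,s)}$, and the heights do not change otherwise. That is, $H$ is the (least) solution of $$H_{(x,t)}=\max\Big(H_{(x,0)},\ \sup\Big\{\sigma_{(z,s)}+\sup_{y\in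 C_{(z,s)}+z}H_{(y,s)}\ :\ (z,s)\in\Phi,\ 0\le s<t,\ x\in C_{(z,s)}+z\Big\}\Big),\qquad x\in\mathbb{R}^d,\ t\ge 0.$$ The footprint of the stick heap at time $t$ is $F_t=\{x\in\mathbb{R}^d: H_{(x,t)}\ge 0\}$, and for $K\subset\mathbb{R}^d$ let $\tau(K)=\inf\{t\in[0,\infty): K\setminus F_t=\emptyset\}$, with $\inf\emptyset=\infty$. **Corollary.** Assume that $\lambda>0$ and that, with positive probability, the interior of $C$ contains the origin (Assumption I). Then for every bounded set $K\subset\mathbb{R}^d$, $\tau(K)<\infty$ almost surely. -/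

import Mathlib

open MeasureTheory ProbabilityTheory TopologicalSpace
open scoped NNReal ENNReal Pointwise

noncomputable section

namespace PoissonHail

/-- The ground `ℝ^d`. -/
abbrev Ground (d : ℕ) : Type := EuclideanSpace ℝ (Fin d)

/-- The hit-or-miss sigma-algebra on the closed subsets of `ℝ^d` (Matheron), generated by the events
`{F | F ∩ K ≠ ∅}` with `K` compact. A random closed set is a random variable with values in
`Closeds (Ground d)` endowed with it. -/
instance hitOrMiss (d : ℕ) : MeasurableSpace (Closeds (Ground d)) :=
  MeasurableSpace.generateFrom
    {A | ∃ K : Set (Ground d), IsCompact K ∧ A = {F : Closeds (Ground d) | ((F : Set (Ground d)) ∩ K).Nonempty}}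

/-- A hailstone: a closed subset of `ℝ^d` and a nonnegative height. -/
abbrev Hailstone (d : ℕ) : Type := Closeds (Ground d) × ℝ≥0

/-- The random data of the model: a random finite or infinite sequence of points of `ℝ^d × ℝ`
(the terms of index `n < num ω`), and with each point a random hailstone, positioned relatively to
the origin. -/
structure Rain (d : ℕ) (Ω : Type*) [MeasurableSpace Ω] where
  /-- the total number of points -/
  num : Ω → ℕ∞
  /-- the `n`-th point `(x, t)`: location and arrival time -/
  point : ℕ → Ω → Ground d × ℝ
  /-- the mark `(C, σ)` of the `n`-th point -/
  mark : ℕ → Ω → Hailstone d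
  measurable_num : Measurable num
  measurable_point : ∀ n, Measurable (point n)
  measurable_mark : ∀ n, Measurable (mark n)

variable {d : ℕ} {Ω : Type*} [MeasurableSpace Ω]

/-- The counting measure `Φ(A)`: the number of points of the rain in `A`. -/
def Rain.count (R : Rain d Ω) (A : Set (Ground d × ℝ)) (ω : Ω) : ℕ∞ :=
  {n : ℕ | (n : ℕ∞) < R.num ω ∧ R.point n ω ∈ A}.encard

/-- The points form a homogeneous Poisson point process on `ℝ^d × ℝ` with intensity `lam`, and the
marks are i.i.d. with law `Q`, independent of the points (independent marking). -/
structure Rain.IsMarkedPoisson (R : Rain d Ω) (P : Measure Ω) (lam : ℝ≥0)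
    (Q : Measure (Hailstone d)) : Prop where
  count_law : ∀ A : Set (Ground d × ℝ), MeasurableSet A → volume A ≠ ∞ → ∀ k : ℕ,
    P {ω | R.count A ω = k} = poissonMeasure (lam * (volume A).toNNReal) {k}
  count_indep : ∀ (m : ℕ) (A : Fin m → Set (Ground d × ℝ)), (∀ i, MeasurableSet (A i)) →
    (∀ i j, i ≠ j → Disjoint (A i) (A j)) → iIndepFun (fun i => R.count (A i)) P
  mark_law : ∀ n, HasLaw (R.mark n) Q P
  mark_indep : iIndepFun R.mark P
  mark_indep_point :
    IndepFun (fun ω => (R.num ω, fun n => R.point n ω)) (fun ω n => R.mark n ω) P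

/-- Light tails, for the law `Q` of the typical hailstone `(C, σ)`: for some `c > 0`, both
`exp (c ξ^d)` and `exp (c σ)` have finite expectations, `ξ` being the diameter of `C`
(finite almost surely: `Metric.diam` is the diameter only of a bounded set). -/
def LightTailed (Q : Measure (Hailstone d)) : Prop :=
  (∀ᵐ m ∂Q, Bornology.IsBounded (m.1 : Set (Ground d))) ∧
  ∃ c : ℝ, 0 < c ∧
    ∫⁻ m, ENNReal.ofReal (Real.exp (c * Metric.diam (m.1 : Set (Ground d)) ^ d)) ∂Q < ∞ ∧
    ∫⁻ m, ENNReal.ofReal (Real.exp (c * (m.2 : ℝ))) ∂Q < ∞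

/-- Assumption I: with positive probability the interior of the typical random closed set `C`
contains the origin. -/
def AssumptionI (Q : Measure (Hailstone d)) : Prop :=
  0 < Q {m | (0 : Ground d) ∈ interior (m.1 : Set (Ground d))}

/-- The `n`-th hailstone at its place on the ground: `C_{(x,t)} + x`. -/
def Rain.placed (R : Rain d Ω) (ω : Ω) (n : ℕ) : Set (Ground d) :=
  (R.point n ω).1 +ᵥ ((R.mark n ω).1 : Set (Ground d))

/-- The height at time `0`: `0` on the substrate, `-∞` elsewhere. -/
def initialHeight (S : Set (Ground d)) (x : Ground d) : EReal :=
  ⨆ _ : x ∈ S, (0 : EReal)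

/-- The hailstones which arrive during `[u, t)` and hit the location `x` (the points of `N^x` in
`[u, t)`). -/
def Rain.hits (R : Rain d Ω) (ω : Ω) (x : Ground d) (u t : ℝ) : Set ℕ :=
  {n | (n : ℕ∞) < R.num ω ∧ (R.point n ω).2 ∈ Set.Ico u t ∧ x ∈ R.placed ω n}

/-- The height reached by the top of the `n`-th hailstone `(C + x, σ)`, which arrives at time `s`,
if the heights are given by `H`: `σ + sup_{y ∈ C + x} H (y, s)`. It is `-∞` if the hailstone falls
outside of the heap. -/
def Rain.top (R : Rain d Ω) (ω : Ω) (H : Ground d → ℝ → EReal) (n : ℕ) : EReal :=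
  (((R.mark n ω).2 : ℝ) : EReal) + ⨆ y ∈ R.placed ω n, H y (R.point n ω).2

/-- The right-hand side of the recursion for the heights, started at time `0` from the substrate
`S`: at each arrival of a hailstone that hits `x`, the height at `x` rises to the top of that
hailstone. -/
def Rain.step (R : Rain d Ω) (S : Set (Ground d)) (ω : Ω) :
    (Ground d → ℝ → EReal) →o (Ground d → ℝ → EReal) where
  toFun H x t := initialHeight S x ⊔ ⨆ n ∈ R.hits ω x 0 t, R.top ω H n
  monotone' := by
    intro H H' h x t
    refine sup_le_sup le_rfl (iSup₂_mono fun n _ => ?_)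
    exact add_le_add le_rfl (iSup₂_mono fun y _ => h y _)

/-- The height `H_{(x,t)}` of the heap over `x` at time `t`, with initial substrate `S`: the (least)
solution of the recursion for the heights. -/
def Rain.height (R : Rain d Ω) (S : Set (Ground d)) (ω : Ω) : Ground d → ℝ → EReal :=
  OrderHom.lfp (R.step S ω)

/-- The footprint (spatial projection) `F_t` of the stick heap, the heap with substrate `{0}`. -/
def Rain.footprint (R : Rain d Ω) (ω : Ω) (t : ℝ) : Set (Ground d) :=
  {x | 0 ≤ R.height {0} ω x t}

/-- The time `τ(K)` at which the footprint of the stick heap covers `K`; it is `∞` if this never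
happens. -/
def Rain.coverTime (R : Rain d Ω) (K : Set (Ground d)) (ω : Ω) : ℝ≥0∞ :=
  ⨅ (t : ℝ≥0) (_ : K \ R.footprint ω t = ∅), (t : ℝ≥0∞)

/-- The height solves its recursion. -/
theorem Rain.height_eq (R : Rain d Ω) (S : Set (Ground d)) (ω : Ω) (x : Ground d) (t : ℝ) :
    R.height S ω x t = initialHeight S x ⊔ ⨆ n ∈ R.hits ω x 0 t, R.top ω (R.height S ω) n :=
  (congrFun (congrFun (OrderHom.map_lfp (R.step S ω)) x) t).symm

/-- The initial condition. -/
theorem Rain.height_zero (R : Rain d Ω) (S : Set (Ground d)) (ω : Ω) (x : Ground d) :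
    R.height S ω x 0 = initialHeight S x := by
  rw [R.height_eq]
  simp [Rain.hits]

/-- The recursion between two times `0 ≤ u ≤ t`. -/
theorem Rain.height_eq_sup (R : Rain d Ω) (S : Set (Ground d)) (ω : Ω) (x : Ground d) {u t : ℝ}
    (hu : 0 ≤ u) (hut : u ≤ t) :
    R.height S ω x t = R.height S ω x u ⊔ ⨆ n ∈ R.hits ω x u t, R.top ω (R.height S ω) n := by
  have h : R.hits ω x 0 t = R.hits ω x 0 u ∪ R.hits ω x u t := by
    ext n
    simp only [Rain.hits, Set.mem_union, Set.mem_ofPred_eq, Set.mem_Ico]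
    grind
  rw [R.height_eq S ω x t, R.height_eq S ω x u, h, iSup_union, sup_assoc]

/-- A single hailstone that hits `x` during `[u, t)`, at time `s`, raises the height at `x` from
`H (x, u) = H (x, s)` to `σ + sup_{y ∈ C + z} H (y, s)`. Thus the height has the jumps and the
intervals of constancy that the integral form of the recursion prescribes. -/
theorem Rain.height_jump (R : Rain d Ω) (S : Set (Ground d)) (ω : Ω) (x : Ground d) {u t : ℝ}
    (hu : 0 ≤ u) (n : ℕ) (hn : R.hits ω x u t = {n}) :
    R.height S ω x (R.point n ω).2 = R.height S ω x u ∧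
      R.height S ω x t = R.top ω (R.height S ω) n := by
  have hmem : n ∈ R.hits ω x u t := by rw [hn]; rfl
  obtain ⟨-, ⟨h1, h2⟩, h3⟩ := id hmem
  have hempty : R.hits ω x u (R.point n ω).2 = ∅ := by
    ext k
    simp only [Set.mem_empty_iff_false, iff_false]
    rintro ⟨k1, ⟨k2, k3⟩, k4⟩
    have : k ∈ R.hits ω x u t := ⟨k1, ⟨k2, k3.trans h2⟩, k4⟩
    rw [hn, Set.mem_singleton_iff] at this
    subst this
    exact lt_irrefl _ k3
  have heq : R.height S ω x (R.point n ω).2 = R.height S ω x u := by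
    rw [R.height_eq_sup S ω x hu h1, hempty]
    simp
  refine ⟨heq, ?_⟩
  rw [R.height_eq_sup S ω x hu (h1.trans h2.le), hn, ← heq]
  simp only [Set.mem_singleton_iff, iSup_iSup_eq_left, sup_eq_right]
  have h4 : R.height S ω x (R.point n ω).2 ≤ ⨆ y ∈ R.placed ω n, R.height S ω y (R.point n ω).2 :=
    le_iSup₂_of_le x h3 le_rfl
  refine h4.trans ?_
  have h5 : (0 : EReal) ≤ (((R.mark n ω).2 : ℝ) : EReal) := by
    exact_mod_cast (R.mark n ω).2.2
  simpa [Rain.top] using add_le_add h5 (le_refl (⨆ y ∈ R.placed ω n, R.height S ω y (R.point n ω).2))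

end PoissonHail

end

/-!
The footprint grows by every hailstone that touches it. By Assumption I there is `r > 0` such that,
with positive probability, a hailstone contains the ball of radius `8 * r` about its position
(`AssumptionI.exists_ball`).

In a fixed ball `B` and after a fixed time `T`, infinitely many points of the rain arrive: the number
of points in `B × [T, T + m)` has a Poisson law whose parameter tends to infinity with `m`, so that
its probability of being at most `k` tends to zero (`Rain.IsMarkedPoisson.ae_infinite`). The indices
of these points form a random infinite set independent of the i.i.d. marks, hence one of them carries
a hailstone that contains the ball of radius `8 * r`
(`Rain.IsMarkedPoisson.ae_exists_mark_mem`).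

Almost surely this holds simultaneously for all balls of radius `r` centred in a countable dense set
and all natural times `T`. The rest is deterministic: once the ball of radius `k * r` about the
origin is covered by the footprint, each point of the ball of radius `(k + 1) * r` has a
neighbourhood that is covered some finite time later, and by compactness so is the whole ball
(`Rain.closedBall_subset_footprint`).
-/

open Filter Topology Metric

namespace PoissonHail

variable {d : ℕ} {Ω : Type*} [MeasurableSpace Ω]

/-! ### Growth of the footprint -/

theorem Rain.height_mono (R : Rain d Ω) (S : Set (Ground d)) (ω : Ω) (x : Ground d) :
    Monotone (R.height S ω x) := by
  intro u t hut
  rw [R.height_eq S ω x u, R.height_eq S ω x t]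
  refine sup_le_sup le_rfl (biSup_mono fun n hn => ?_)
  exact ⟨hn.1, ⟨hn.2.1.1, hn.2.1.2.trans_le hut⟩, hn.2.2⟩

theorem Rain.footprint_mono (R : Rain d Ω) (ω : Ω) : Monotone (R.footprint ω) :=
  fun _ _ hut x hx => le_trans (α := EReal) hx (R.height_mono {0} ω x hut)

theorem Rain.zero_mem_footprint (R : Rain d Ω) (ω : Ω) (t : ℝ) : (0 : Ground d) ∈ R.footprint ω t := by
  change (0 : EReal) ≤ R.height {0} ω 0 t
  rw [R.height_eq]
  exact le_sup_of_le_left (by simp [initialHeight])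

/-- A hailstone that touches the footprint when it arrives is added to the footprint. -/
theorem Rain.placed_subset_footprint (R : Rain d Ω) (ω : Ω) {n : ℕ} (hn : (n : ℕ∞) < R.num ω)
    (h0 : 0 ≤ (R.point n ω).2) {y : Ground d} (hy : y ∈ R.placed ω n)
    (hyF : y ∈ R.footprint ω (R.point n ω).2) {t : ℝ} (ht : (R.point n ω).2 < t) :
    R.placed ω n ⊆ R.footprint ω t := by
  intro x hx
  change (0 : EReal) ≤ R.height {0} ω x t
  rw [R.height_eq]
  have hhit : n ∈ R.hits ω x 0 t := ⟨hn, ⟨h0, ht⟩, hx⟩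
  refine le_sup_of_le_right (le_iSup₂_of_le n hhit (add_nonneg ?_ ?_))
  · exact_mod_cast (R.mark n ω).2.2
  · exact le_iSup₂_of_le y hy hyF

/-- If, near every location of a dense set and after every time, some hailstone arrives that
contains a ball of radius `8 * r` about its position, then the footprint covers every ball about
the origin in finite time. The radius of the ball grows by `r` at each step: a point `x` within
`r` of a covered point `x'` has a whole neighbourhood `ball x r` inside any stone of radius `8 * r`
positioned within `2 * r` of `x'`, and finitely many such neighbourhoods cover the larger ball. -/
theorem Rain.closedBall_subset_footprint (R : Rain d Ω) (ω : Ω) {r : ℝ} (hr : 0 < r)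
    {D : Set (Ground d)} (hD : Dense D)
    (h : ∀ q ∈ D, ∀ T : ℕ, ∃ n : ℕ, (n : ℕ∞) < R.num ω ∧
      R.point n ω ∈ ball q r ×ˢ Set.Ici (T : ℝ) ∧
      ball 0 (8 * r) ⊆ ((R.mark n ω).1 : Set (Ground d))) (k : ℕ) :
    ∃ t : ℝ≥0, closedBall 0 (k * r) ⊆ R.footprint ω t := by
  induction k with
  | zero =>
    refine ⟨0, fun x hx => ?_⟩
    obtain rfl : x = 0 := by simpa using hx
    exact R.zero_mem_footprint ω _
  | succ k ih =>
    obtain ⟨t, ht⟩ := ih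
    have hcompact : IsCompact (closedBall (0 : Ground d) ((k + 1 : ℕ) * r)) :=
      isCompact_closedBall _ _
    refine hcompact.induction_on (p := fun s => ∃ t : ℝ≥0, s ⊆ R.footprint ω t)
      ⟨0, Set.empty_subset _⟩ (fun s s' hs ⟨t, h⟩ => ⟨t, hs.trans h⟩) ?_ ?_
    · rintro s s' ⟨t, h⟩ ⟨t', h'⟩
      exact ⟨t ⊔ t', Set.union_subset
        (h.trans (R.footprint_mono ω (by exact_mod_cast le_sup_left)))
        (h'.trans (R.footprint_mono ω (by exact_mod_cast le_sup_right)))⟩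
    intro x hx
    -- the radial projection of `x` to the smaller ball
    obtain ⟨x', hx', hxx'⟩ : ∃ x' ∈ closedBall (0 : Ground d) (k * r), dist x x' ≤ r := by
      refine ⟨((k : ℝ) / (k + 1)) • x, ?_, ?_⟩
      all_goals
        have hx1 : ‖x‖ ≤ (k + 1) * r := by simpa using hx
        have hk : (0 : ℝ) < k + 1 := by positivity
      · rw [mem_closedBall_zero_iff, norm_smul, Real.norm_of_nonneg (by positivity)]
        calc (k : ℝ) / (k + 1) * ‖x‖ ≤ k / (k + 1) * ((k + 1) * r) := by gcongr
          _ = k * r := by field_simp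
      · have : x - ((k : ℝ) / (k + 1)) • x = (1 / ((k : ℝ) + 1)) • x := by
          rw [show 1 / ((k : ℝ) + 1) = 1 - k / (k + 1) by field_simp; ring, sub_smul, one_smul]
        rw [dist_eq_norm, this, norm_smul, Real.norm_of_nonneg (by positivity)]
        calc 1 / ((k : ℝ) + 1) * ‖x‖ ≤ 1 / (k + 1) * ((k + 1) * r) := by gcongr
          _ = r := by field_simp
    obtain ⟨q, hq, hqx'⟩ := hD.exists_dist_lt x' hr
    obtain ⟨T, hT⟩ := exists_nat_ge (t : ℝ)
    obtain ⟨n, hn, ⟨hz, hs⟩, hC⟩ := h q hq T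
    have hs : (T : ℝ) ≤ (R.point n ω).2 := hs
    have h0 : 0 ≤ (R.point n ω).2 := le_trans (by positivity) hs
    have hmem : ∀ y, dist y (R.point n ω).1 < 8 * r → y ∈ R.placed ω n := by
      intro y hy
      refine ⟨y - (R.point n ω).1, hC ?_, by simp⟩
      rwa [mem_ball_zero_iff, ← dist_eq_norm]
    have hzx' : dist x' (R.point n ω).1 < 2 * r := by
      have := dist_triangle_right x' (R.point n ω).1 q
      rw [mem_ball] at hz
      linarith
    have hcover := R.placed_subset_footprint ω hn h0 (hmem x' (by linarith))
      (R.footprint_mono ω (hT.trans hs) (ht hx')) (lt_add_one _)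
    refine ⟨ball x r, mem_nhdsWithin_of_mem_nhds (ball_mem_nhds x hr),
      ⟨(R.point n ω).2 + 1, by positivity⟩, fun y hy => hcover (hmem y ?_)⟩
    have h1 := dist_triangle4 y x x' (R.point n ω).1
    rw [mem_ball] at hy
    linarith

/-! ### Large hailstones -/

theorem measurableSet_ball_subset (r : ℝ) :
    MeasurableSet {m : Hailstone d | ball (0 : Ground d) r ⊆ (m.1 : Set (Ground d))} := by
  have hpt (x : Ground d) : MeasurableSet {F : Closeds (Ground d) | x ∈ (F : Set (Ground d))} :=
    MeasurableSpace.measurableSet_generateFrom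
      ⟨{x}, isCompact_singleton, by ext F; simp [Set.inter_singleton_nonempty]⟩
  obtain ⟨D, hDc, hD⟩ := exists_countable_dense (Ground d)
  have : {m : Hailstone d | ball (0 : Ground d) r ⊆ (m.1 : Set (Ground d))} =
      ⋂ x ∈ D ∩ ball 0 r, Prod.fst ⁻¹' {F : Closeds (Ground d) | x ∈ (F : Set (Ground d))} := by
    ext m
    simp only [Set.mem_iInter]
    refine ⟨fun h x hx => h hx.2, fun h => ?_⟩
    change ball (0 : Ground d) r ⊆ (m.1 : Set (Ground d))
    refine (hD.open_subset_closure_inter isOpen_ball).trans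
      (closure_minimal (fun x hx => h x ⟨hx.2, hx.1⟩) m.1.isClosed)
  rw [this]
  exact MeasurableSet.biInter (hDc.mono Set.inter_subset_left) fun x _ => measurable_fst (hpt x)

theorem AssumptionI.exists_ball {Q : Measure (Hailstone d)} (hI : AssumptionI Q) :
    ∃ r : ℝ, 0 < r ∧ Q {m | ball (0 : Ground d) (8 * r) ⊆ (m.1 : Set (Ground d))} ≠ 0 := by
  by_contra! h
  refine hI.ne' (measure_mono_null (t := ⋃ k : ℕ, {m : Hailstone d |
    ball (0 : Ground d) (8 * (1 / ((k : ℝ) + 1))) ⊆ (m.1 : Set (Ground d))}) (fun m hm => ?_)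
    (measure_iUnion_null fun k => h _ (by positivity)))
  obtain ⟨ε, hε, hb⟩ := Metric.isOpen_iff.1 isOpen_interior 0 hm
  obtain ⟨k, hk⟩ := exists_nat_one_div_lt (div_pos hε (by norm_num : (0 : ℝ) < 8))
  exact Set.mem_iUnion.2
    ⟨k, ((ball_subset_ball (by linarith)).trans hb).trans interior_subset⟩

/-! ### Recurrence of large hailstones -/

theorem tendsto_poissonMeasure_singleton (k : ℕ) :
    Tendsto (fun a : ℝ≥0 => poissonMeasure a {k}) atTop (𝓝 0) := by
  simp_rw [poissonMeasure_singleton]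
  rw [← ENNReal.ofReal_zero]
  refine ENNReal.tendsto_ofReal ?_
  have h := ((Real.tendsto_pow_mul_exp_neg_atTop_nhds_zero k).comp
    (NNReal.tendsto_coe_atTop.2 tendsto_id)).div_const (k.factorial : ℝ)
  simpa [mul_comm] using h

/-- A region with subsets of finite volumes tending to infinity a.s. contains infinitely many points
of the rain: the probability that it has at most `k` points is at most that of each subset having
at most `k` points, a Poisson probability that tends to zero. -/
theorem Rain.IsMarkedPoisson.ae_infinite {P : Measure Ω} {R : Rain d Ω} {lam : ℝ≥0}
    {Q : Measure (Hailstone d)} (hR : R.IsMarkedPoisson P lam Q) (hlam : 0 < lam)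
    {A : Set (Ground d × ℝ)} {B : ℕ → Set (Ground d × ℝ)} (hBm : ∀ m, MeasurableSet (B m))
    (hBA : ∀ m, B m ⊆ A) (hB : ∀ m, volume (B m) ≠ ∞)
    (hlim : Tendsto (fun m => (volume (B m)).toNNReal) atTop atTop) :
    ∀ᵐ ω ∂P, {n : ℕ | (n : ℕ∞) < R.num ω ∧ R.point n ω ∈ A}.Infinite := by
  have hle (k : ℕ) : P {ω | R.count A ω ≤ k} = 0 := by
    have hsum : Tendsto (fun m => ∑ j ∈ Finset.range (k + 1),
        poissonMeasure (lam * (volume (B m)).toNNReal) {j}) atTop (𝓝 0) := by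
      rw [← Finset.sum_const_zero (s := Finset.range (k + 1))]
      exact tendsto_finsetSum _ fun j _ => (tendsto_poissonMeasure_singleton j).comp
        (hlim.const_mul_atTop hlam)
    refine le_antisymm (ge_of_tendsto' hsum fun m => ?_) zero_le
    calc P {ω | R.count A ω ≤ k}
        ≤ P (⋃ j ∈ Finset.range (k + 1), {ω | R.count (B m) ω = j}) := by
          refine measure_mono fun ω hω => ?_
          have h1 : R.count (B m) ω ≤ k :=
            by
            refine le_trans (Set.encard_le_encard ?_) hω
            exact fun n hn => ⟨hn.1, hBA m hn.2⟩
          obtain ⟨j, hj⟩ := ENat.ne_top_iff_exists.1 (ne_top_of_le_ne_top (ENat.natCast_ne_top k) h1)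
          rw [← hj] at h1
          refine Set.mem_iUnion₂.2 ⟨j, ?_, hj.symm⟩
          exact Finset.mem_range_succ_iff.2 (by exact_mod_cast h1)
      _ ≤ ∑ j ∈ Finset.range (k + 1), P {ω | R.count (B m) ω = j} :=
          measure_biUnion_finset_le _ _
      _ = _ := Finset.sum_congr rfl fun j _ => hR.count_law _ (hBm m) (hB m) j
  filter_upwards [ae_all_iff.2 fun k => measure_eq_zero_iff_ae_notMem.1 (hle k)] with ω hω hfin
  exact hω hfin.toFinset.card hfin.encard_eq_coe_toFinset_card.le

/-- Infinitely many independent trials with the same positive probability of success do not all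
fail. -/
theorem measure_forall_notMem_eq_zero {E : Type*} [MeasurableSpace E] {P : Measure Ω}
    {Q : Measure E} [IsProbabilityMeasure Q] {X : ℕ → Ω → E} (hX : ∀ n, HasLaw (X n) Q P)
    (hind : iIndepFun X P) {M : Set E} (hM : MeasurableSet M) (hQM : Q M ≠ 0) {I : Set ℕ}
    (hI : I.Infinite) : P {ω | ∀ n ∈ I, X n ω ∉ M} = 0 := by
  have hq : Q Mᶜ < 1 := by
    rw [prob_compl_eq_one_sub hM]
    exact ENNReal.sub_lt_self ENNReal.one_ne_top one_ne_zero hQM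
  refine le_antisymm (ge_of_tendsto' (ENNReal.tendsto_pow_atTop_nhds_zero_of_lt_one hq)
    fun m => ?_) zero_le
  obtain ⟨s, hsI, rfl⟩ := hI.exists_subset_card_eq m
  calc P {ω | ∀ n ∈ I, X n ω ∉ M} ≤ P (⋂ n ∈ s, X n ⁻¹' Mᶜ) :=
        measure_mono fun ω hω => Set.mem_iInter₂.2 fun n hn => hω n (hsI hn)
    _ = ∏ n ∈ s, P (X n ⁻¹' Mᶜ) :=
        hind.measure_inter_preimage_eq_mul s fun _ _ => hM.compl
    _ = Q Mᶜ ^ s.card := by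
        refine Finset.prod_eq_pow_card fun n _ => ?_
        exact (hX n).measure_eq hM.compl

/-- A region that a.s. contains infinitely many points a.s. contains a point whose mark lies in a
given set of positive probability: the marks are independent of the random infinite set of the
indices of these points, which can therefore be fixed. -/
theorem Rain.IsMarkedPoisson.ae_exists_mark_mem {P : Measure Ω} [IsProbabilityMeasure P]
    {R : Rain d Ω} {lam : ℝ≥0} {Q : Measure (Hailstone d)} (hR : R.IsMarkedPoisson P lam Q)
    {A : Set (Ground d × ℝ)} (hA : MeasurableSet A)
    (hinf : ∀ᵐ ω ∂P, {n : ℕ | (n : ℕ∞) < R.num ω ∧ R.point n ω ∈ A}.Infinite)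
    {M : Set (Hailstone d)} (hM : MeasurableSet M) (hQM : Q M ≠ 0) :
    ∀ᵐ ω ∂P, ∃ n : ℕ, (n : ℕ∞) < R.num ω ∧ R.point n ω ∈ A ∧ R.mark n ω ∈ M := by
  have hQ : IsProbabilityMeasure Q := (hR.mark_law 0).isProbabilityMeasure_iff.1 inferInstance
  have hf : Measurable fun ω => (R.num ω, fun n => R.point n ω) :=
    R.measurable_num.prodMk (measurable_pi_lambda _ R.measurable_point)
  have hg : Measurable fun ω n => R.mark n ω := measurable_pi_lambda _ R.measurable_mark
  -- the event, in terms of the points and the marks, that no relevant mark lies in `M`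
  let bad : Set ((ℕ∞ × (ℕ → Ground d × ℝ)) × (ℕ → Hailstone d)) :=
    {p | ∀ n : ℕ, (n : ℕ∞) < p.1.1 ∧ p.1.2 n ∈ A → p.2 n ∉ M}
  have hbad : MeasurableSet bad := by
    simp only [bad, Set.ofPred_forall]
    refine MeasurableSet.iInter fun n => MeasurableSet.imp (MeasurableSet.inter ?_ ?_) ?_
    · exact (measurable_fst.comp measurable_fst) (MeasurableSet.of_discrete (s := Set.Ioi (n : ℕ∞)))
    · exact ((measurable_pi_apply n).comp (measurable_snd.comp measurable_fst)) hA
    · have hn : Measurable fun p : (ℕ∞ × (ℕ → Ground d × ℝ)) × (ℕ → Hailstone d) => p.2 n :=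
        (measurable_pi_apply n).comp measurable_snd
      exact hn hM.compl
  have hnull : P ((fun ω => ((R.num ω, fun n => R.point n ω), fun n => R.mark n ω)) ⁻¹' bad) = 0 := by
    rw [← Measure.map_apply (hf.prodMk hg) hbad,
      hR.mark_indep_point.map_prod_eq_prod_map_map hf.aemeasurable hg.aemeasurable,
      Measure.measure_prod_null hbad]
    refine (ae_map_iff hf.aemeasurable
      (measurable_measure_prodMk_left hbad (measurableSet_singleton 0))).2 ?_
    filter_upwards [hinf] with ω hω
    change P.map _ _ = 0
    rw [Measure.map_apply hg (measurable_prodMk_left hbad)]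
    exact measure_forall_notMem_eq_zero hR.mark_law hR.mark_indep hM hQM hω
  filter_upwards [measure_eq_zero_iff_ae_notMem.1 hnull] with ω hω
  by_contra! h
  exact hω fun n hn => h n hn.1 hn.2

theorem Rain.IsMarkedPoisson.ae_infinite_ball {P : Measure Ω} {R : Rain d Ω} {lam : ℝ≥0}
    {Q : Measure (Hailstone d)} (hR : R.IsMarkedPoisson P lam Q) (hlam : 0 < lam)
    (q : Ground d) {r : ℝ} (hr : 0 < r) (T : ℝ) :
    ∀ᵐ ω ∂P, {n : ℕ | (n : ℕ∞) < R.num ω ∧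
      R.point n ω ∈ ball q r ×ˢ Set.Ici T}.Infinite := by
  have hvol (m : ℕ) : volume (ball q r ×ˢ Set.Ico T (T + m)) = volume (ball q r) * m := by
    rw [Measure.volume_eq_prod, Measure.prod_prod, Real.volume_Ico]
    simp
  have hfin : volume (ball q r) ≠ ∞ := measure_ball_lt_top.ne
  have hpos : 0 < (volume (ball q r)).toNNReal :=
    ENNReal.toNNReal_pos (measure_ball_pos _ _ hr).ne' hfin
  refine hR.ae_infinite hlam (B := fun m : ℕ => ball q r ×ˢ Set.Ico T (T + m))
    (fun m => measurableSet_ball.prod measurableSet_Ico)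
    (fun m => Set.prod_mono le_rfl Set.Ico_subset_Ici_self) (fun m => ?_) ?_
  · rw [hvol]
    exact ENNReal.mul_ne_top hfin (ENNReal.natCast_ne_top m)
  · simp_rw [hvol, ENNReal.toNNReal_mul, ENNReal.toNNReal_natCast]
    exact tendsto_natCast_atTop_atTop.const_mul_atTop hpos

end PoissonHail

/-! ### Coverage in finite time -/

theorem corollary3p1 {d : ℕ} {Ω : Type*} [MeasurableSpace Ω] (P : Measure Ω)
    [IsProbabilityMeasure P] (R : PoissonHail.Rain d Ω) (lam : ℝ≥0)
    (Q : Measure (PoissonHail.Hailstone d)) (hR : R.IsMarkedPoisson P lam Q)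
    (hQ : PoissonHail.LightTailed Q) (hlam : 0 < lam) (hI : PoissonHail.AssumptionI Q)
    (K : Set (PoissonHail.Ground d)) (hK : Bornology.IsBounded K) :
    ∀ᵐ ω ∂P, R.coverTime K ω < ∞ := by
  obtain ⟨r, hr, hQr⟩ := hI.exists_ball
  obtain ⟨D, hDc, hD⟩ := exists_countable_dense (PoissonHail.Ground d)
  have hrec : ∀ᵐ ω ∂P, ∀ q ∈ D, ∀ T : ℕ, ∃ n : ℕ, (n : ℕ∞) < R.num ω ∧
      R.point n ω ∈ ball q r ×ˢ Set.Ici (T : ℝ) ∧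
      ball 0 (8 * r) ⊆ ((R.mark n ω).1 : Set (PoissonHail.Ground d)) :=
    (ae_ball_iff hDc).2 fun q _ => ae_all_iff.2 fun T =>
      hR.ae_exists_mark_mem (measurableSet_ball.prod measurableSet_Ici)
        (hR.ae_infinite_ball hlam q hr T) (PoissonHail.measurableSet_ball_subset (8 * r)) hQr
  filter_upwards [hrec] with ω hω
  obtain ⟨ρ, hρ⟩ := hK.subset_closedBall 0
  obtain ⟨k, hk⟩ := exists_nat_ge (ρ / r)
  obtain ⟨t, ht⟩ := R.closedBall_subset_footprint ω hr hD hω k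
  have hKt : K \ R.footprint ω t = ∅ := Set.sdiff_eq_empty.2
    ((hρ.trans (closedBall_subset_closedBall ((div_le_iff₀ hr).1 hk))).trans ht)
  exact (iInf₂_le t hKt).trans_lt ENNReal.coe_lt_top
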